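/- Let $b,c\in\mathbf{R}$ and let $w=w(x,t)$ be a bounded classical solution of the heat equation \[ w_t-w_{xx}=0\quad\text{in}\quad(-\infty,0)\times(0,\infty) \] with the Robin boundary condition $w_x(0,t)+b\,w(0,t)=0$ for $t>0$ and the initial condition $w(x,0)=-c$ for $x<0$; here $w$ is continuous on $(-\infty,0]\times[0,\infty)$, the derivatives $w_t,w_x,w_{xx}$ exist at every point of $(-\infty,0)\times(0,\infty)$, and $w_x(0,t)$ denotes the one-sided derivative at $x=0$. Put $\xi(t)=w(0,t)$ for $t\ge 0$. Then $\xi(0)=-c$, $\xi$ is continuous on $[0,\infty)$ and differentiable on $(0,\infty)$, $\xi'$ is integrable on $(0,t)$ for every $t>0$, and, with $f_\beta^\alpha(t)=e^{-\alpha t}t^{\beta-1}/\Gamma(\beta)$, \[ \int_0^t f_{1/2}^0(t-s)\,\xi'(s)\,ds=-b\,\xi(t)\quad\text{for all } t>0, \] where the integral converges absolutely. In other words, $\partial_t^{1/2}\xi=-b\xi$ on $(0,\infty)$, where \[ \partial_t^{\gamma}\xi(t)=\frac{1}{\Gamma(1-\gamma)}\int_0^t (t-s)^{-\gamma}\,\xi'(s)\,ds\qquad(0<\gamma<1)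 \] is the Caputo derivative. -/

import Mathlib

open Set MeasureTheory

noncomputable section

/-- The kernel `f_β^α(t) = e^{-α t} t^{β-1} / Γ(β)`, for `t > 0`. -/
def fracKernel (α β t : ℝ) : ℝ :=
  Real.exp (-α * t) * t ^ (β - 1) / Real.Gamma β

/-- The Caputo derivative of order `γ ∈ (0,1)` with base point `0`:
`(∂_t^γ ξ)(t) = (1 / Γ(1 - γ)) ∫_0^t (t - s)^{-γ} ξ'(s) ds`. -/
def caputoDeriv (γ : ℝ) (ξ : ℝ → ℝ) (t : ℝ) : ℝ :=
  (Real.Gamma (1 - γ))⁻¹ * ∫ s in (0 : ℝ)..t, (t - s) ^ (-γ) * deriv ξ s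

/-- `w` (with `w x t` its value at position `x` and time `t`) is a bounded classical solution of
the heat equation `w_t - w_xx = 0` in `(-∞,0) × (0,∞)` with the Robin boundary condition
`w_x(0,t) + b w(0,t) = 0` for `t > 0` and the initial condition `w(x,0) = -c`.
It is continuous up to the boundary, i.e. on `(-∞,0] × [0,∞)`; only the values of `w` there matter.
The derivative `w_x(0,t)` is the one-sided derivative from inside the domain. -/
structure IsBoundedRobinHeatSolution (b c : ℝ) (w : ℝ → ℝ → ℝ) : Prop where
  continuousOn : ContinuousOn (fun p : ℝ × ℝ => w p.1 p.2) (Iic 0 ×ˢ Ici 0)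
  bounded : ∃ M : ℝ, ∀ x < 0, ∀ t > 0, |w x t| ≤ M
  differentiable_t : ∀ x < 0, ∀ t > 0, DifferentiableAt ℝ (fun s => w x s) t
  differentiable_x : ∀ x < 0, ∀ t > 0, DifferentiableAt ℝ (fun y => w y t) x
  differentiable_xx : ∀ x < 0, ∀ t > 0, DifferentiableAt ℝ (deriv (fun y => w y t)) x
  heat : ∀ x < 0, ∀ t > 0,
    deriv (fun s => w x s) t - deriv (deriv (fun y => w y t)) x = 0
  robin : ∀ t > 0, ∃ d : ℝ,
    HasDerivWithinAt (fun y => w y t) d (Iic 0) 0 ∧ d + b * w 0 t = 0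
  initial : ∀ x < 0, w x 0 = -c

end

/-!
The Robin problem with constant initial value `1` has a classical explicit solution in terms of the
error function (`robinSolution`), with boundary value `E t = e^{b² t} (1 - erf (b √t))`
(`robinBoundary`). A maximum principle shows that solutions of at most exponential growth
`e^{|b| |x|}` are determined by their initial values (`IsRobinHeat.eq_of_initial`), so a bounded
solution with initial value `-c` is `-c` times the explicit one, and `ξ = -c E` on `[0, ∞)`. All
claims thereby become statements about the elementary function `E`.

The maximum principle (`IsRobinHeat.nonpos`) has to hold for both signs of `b`. It divides by a
positive strict supersolution `φ` with `φ_x + b φ > 0` on the boundary (`robinBarrier`): if `v / φ`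
had a positive maximum `ε`, then `v - ε φ` would have maximum `0` at that point, against the heat
equation inside and against the Robin condition on the boundary.

For the fractional equation, `E' t = b² E t - b / √(π t)`, and the substitution `s = t sin² θ` turns
the half-order integral of `E'` into one with a continuous integrand. What remains is
`∫_0^{π/2} erf (a sin θ) d(-erf (a cos θ)) = 1 - e^{-a²}` (`integral_erf_sin_mul`), the Gaussian
mass of a quarter disc. It follows by differentiating the integrand in `a`: the result differs from
a function independent of `θ` by a `θ`-derivative with vanishing boundary values.
-/

open Filter Topology

/-! ### The error function -/

/-- The error function `erf x = (2 / √π) ∫_0^x e^{-s²} ds`. -/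
noncomputable def erf (x : ℝ) : ℝ := 2 / √Real.pi * ∫ s in (0 : ℝ)..x, Real.exp (-s ^ 2)

theorem erf_zero : erf 0 = 0 := by simp [erf]

theorem hasDerivAt_erf (x : ℝ) :
    HasDerivAt erf (2 / √Real.pi * Real.exp (-x ^ 2)) x := by
  have hc : Continuous fun s : ℝ => Real.exp (-s ^ 2) := by fun_prop
  exact (intervalIntegral.integral_hasDerivAt_right (hc.intervalIntegrable _ _)
    (hc.stronglyMeasurableAtFilter _ _) hc.continuousAt).const_mul _

theorem continuous_erf : Continuous erf :=
  continuous_iff_continuousAt.2 fun x => (hasDerivAt_erf x).continuousAt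

theorem erf_neg (x : ℝ) : erf (-x) = -erf x := by
  have h := intervalIntegral.integral_comp_neg (a := 0) (b := x) fun s : ℝ => Real.exp (-s ^ 2)
  simp only [neg_sq, neg_zero] at h
  rw [erf, erf, h, intervalIntegral.integral_symm]
  ring

theorem monotone_erf : Monotone erf :=
  monotone_of_hasDerivAt_nonneg (fun x => hasDerivAt_erf x) fun x => by positivity

theorem tendsto_erf_atTop : Tendsto erf atTop (𝓝 1) := by
  have hi : Integrable fun s : ℝ => Real.exp (-s ^ 2) := by
    simpa using integrable_exp_neg_mul_sq (b := 1) one_pos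
  have hg := integral_gaussian_Ioi 1
  simp only [neg_mul, one_mul, div_one] at hg
  have h := (intervalIntegral_tendsto_integral_Ioi 0 hi.integrableOn tendsto_id).const_mul
    (2 / √Real.pi)
  rw [hg] at h
  have hπ : √Real.pi ≠ 0 := by positivity
  have h1 : 2 / √Real.pi * (√Real.pi / 2) = 1 := by field_simp
  rw [h1] at h
  exact h

theorem erf_le_one (x : ℝ) : erf x ≤ 1 :=
  monotone_erf.ge_of_tendsto tendsto_erf_atTop x

theorem neg_one_le_erf (x : ℝ) : -1 ≤ erf x := by
  have := erf_le_one (-x)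
  rw [erf_neg] at this
  linarith

theorem abs_one_sub_erf_le (x : ℝ) : |1 - erf x| ≤ 2 := by
  rw [abs_of_nonneg (by linarith [erf_le_one x])]
  linarith [neg_one_le_erf x]

theorem abs_erf_sub_erf_le (x y : ℝ) : |erf x - erf y| ≤ 2 / √Real.pi * |x - y| := by
  refine Convex.norm_image_sub_le_of_norm_hasDerivWithin_le (s := univ)
    (fun z _ => (hasDerivAt_erf z).hasDerivWithinAt) (fun z _ => ?_) convex_univ
    (mem_univ y) (mem_univ x)
  rw [Real.norm_of_nonneg (by positivity)]
  refine mul_le_of_le_one_right (by positivity) (Real.exp_le_one_iff.2 ?_)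
  nlinarith [sq_nonneg z]

/-! ### Derivative tests and pointwise solutions of the Robin problem -/

theorem HasDerivWithinAt.nonneg_of_eventually_le_left {f : ℝ → ℝ} {d x : ℝ}
    (hf : HasDerivWithinAt f d (Iic x) x) (h : ∀ᶠ y in 𝓝[<] x, f y ≤ f x) : 0 ≤ d := by
  have hs := hasDerivWithinAt_iff_tendsto_slope.1 hf
  rw [Iic_sdiff_right] at hs
  refine ge_of_tendsto hs ?_
  filter_upwards [h, self_mem_nhdsWithin] with y hy hyx
  rw [slope_def_field]
  exact div_nonneg_of_nonpos (by linarith) (by linarith [mem_Iio.1 hyx])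

/-- The second derivative is nonpositive at a local maximum. -/
theorem IsLocalMax.second_deriv_nonpos {f f' : ℝ → ℝ} {p x : ℝ} (h : IsLocalMax f x)
    (hf : ∀ᶠ y in 𝓝 x, HasDerivAt f (f' y) y) (hf' : HasDerivAt f' p x) : p ≤ 0 := by
  by_contra! hp
  have hd : deriv f =ᶠ[𝓝 x] f' := hf.mono fun y hy => hy.deriv
  have hdd : deriv (deriv f) x = p := by rw [hd.deriv_eq, hf'.deriv]
  have hmin := isLocalMin_of_deriv_deriv_pos (hdd ▸ hp) h.deriv_eq_zero
    hf.self_of_nhds.continuousAt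
  -- being both a local minimum and a local maximum, `x` has a neighbourhood where `f` is constant
  have hconst : f =ᶠ[𝓝 x] fun _ => f x := by
    filter_upwards [h, hmin] with y h1 h2 using le_antisymm h1 h2
  have h0 := hconst.deriv.deriv_eq
  simp only [deriv_const', deriv_const] at h0
  linarith

/-- A function `v` solves the heat equation `v_t = v_xx` in `(-∞,0) × (0,∞)` and satisfies the
Robin condition `v_x + b v = 0` on `x = 0`, `t > 0`, all derivatives existing pointwise. In `heat`,
`f` is `v_x(·, t)` and `p` is the common value of `v_xx` and `v_t` at `(x, t)`. -/
structure IsRobinHeat (b : ℝ) (v : ℝ → ℝ → ℝ) : Prop where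
  heat : ∀ x < 0, ∀ t > 0, ∃ (f : ℝ → ℝ) (p : ℝ),
    (∀ y < 0, HasDerivAt (fun y => v y t) (f y) y) ∧ HasDerivAt f p x ∧
      HasDerivAt (fun s => v x s) p t
  robin : ∀ t > 0, HasDerivWithinAt (fun y => v y t) (-b * v 0 t) (Iic 0) 0

namespace IsRobinHeat

variable {b : ℝ} {u v : ℝ → ℝ → ℝ}

theorem const_mul (k : ℝ) (hv : IsRobinHeat b v) : IsRobinHeat b fun x t => k * v x t where
  heat x hx t ht := by
    obtain ⟨f, p, h1, h2, h3⟩ := hv.heat x hx t ht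
    exact ⟨fun y => k * f y, k * p, fun y hy => (h1 y hy).const_mul k, h2.const_mul k,
      h3.const_mul k⟩
  robin t ht := ((hv.robin t ht).const_mul k).congr_deriv (by ring)

theorem sub (hu : IsRobinHeat b u) (hv : IsRobinHeat b v) :
    IsRobinHeat b fun x t => u x t - v x t where
  heat x hx t ht := by
    obtain ⟨f, p, h1, h2, h3⟩ := hu.heat x hx t ht
    obtain ⟨g, q, k1, k2, k3⟩ := hv.heat x hx t ht
    exact ⟨fun y => f y - g y, p - q, fun y hy => (h1 y hy).sub (k1 y hy), h2.sub k2, h3.sub k3⟩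
  robin t ht := ((hu.robin t ht).sub (hv.robin t ht)).congr_deriv (by ring)

end IsRobinHeat

/-! ### Maximum principle and uniqueness -/

/-- A positive strict supersolution of the Robin problem on `(-∞,0)` that outgrows `e^{-|b| x}` as
`x → -∞`. The summand `2 m e^{m x}` makes the boundary inequality `φ_x + b φ > 0` hold whatever
the sign of `b`. -/
noncomputable def robinBarrier (b x t : ℝ) : ℝ :=
  Real.exp (((|b| + 1) ^ 2 + 1) * t) *
    (Real.exp (-(|b| + 1) * x) + 2 * (|b| + 1) * Real.exp ((|b| + 1) * x))

theorem robinBarrier_pos (b x t : ℝ) : 0 < robinBarrier b x t := by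
  unfold robinBarrier; positivity

theorem continuous_robinBarrier (b : ℝ) :
    Continuous fun p : ℝ × ℝ => robinBarrier b p.1 p.2 := by
  unfold robinBarrier; fun_prop

theorem hasDerivAt_robinBarrier_time (b x t : ℝ) :
    HasDerivAt (fun s => robinBarrier b x s)
      (((|b| + 1) ^ 2 + 1) * robinBarrier b x t) t := by
  unfold robinBarrier
  have h := (((hasDerivAt_id t).const_mul ((|b| + 1) ^ 2 + 1)).exp).mul_const
    (Real.exp (-(|b| + 1) * x) + 2 * (|b| + 1) * Real.exp ((|b| + 1) * x))
  exact h.congr_deriv (by simp; ring)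

theorem hasDerivAt_exp_const_mul (m x : ℝ) :
    HasDerivAt (fun y => Real.exp (m * y)) (m * Real.exp (m * x)) x :=
  (((hasDerivAt_id x).const_mul m).exp).congr_deriv (by simp; ring)

/-- The space derivative of `robinBarrier`. -/
noncomputable def robinBarrierDeriv (b x t : ℝ) : ℝ :=
  Real.exp (((|b| + 1) ^ 2 + 1) * t) *
    (-(|b| + 1) * Real.exp (-(|b| + 1) * x) +
      2 * (|b| + 1) * ((|b| + 1) * Real.exp ((|b| + 1) * x)))

theorem hasDerivAt_robinBarrier (b x t : ℝ) :
    HasDerivAt (fun y => robinBarrier b y t) (robinBarrierDeriv b x t) x :=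
  ((hasDerivAt_exp_const_mul (-(|b| + 1)) x).add
    ((hasDerivAt_exp_const_mul (|b| + 1) x).const_mul (2 * (|b| + 1)))).const_mul _

theorem hasDerivAt_robinBarrierDeriv (b x t : ℝ) :
    HasDerivAt (fun y => robinBarrierDeriv b y t) ((|b| + 1) ^ 2 * robinBarrier b x t) x := by
  refine ((((hasDerivAt_exp_const_mul (-(|b| + 1)) x).const_mul (-(|b| + 1))).add
    (((hasDerivAt_exp_const_mul (|b| + 1) x).const_mul (|b| + 1)).const_mul
      (2 * (|b| + 1)))).const_mul _).congr_deriv ?_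
  unfold robinBarrier; ring

theorem robinBarrier_boundary (b t : ℝ) :
    0 < robinBarrierDeriv b 0 t + b * robinBarrier b 0 t := by
  have h : robinBarrierDeriv b 0 t + b * robinBarrier b 0 t =
      Real.exp (((|b| + 1) ^ 2 + 1) * t) *
        (2 * (|b| + 1) * (|b| + b) + (|b| + 1) + b) := by
    simp only [robinBarrierDeriv, robinBarrier, mul_zero, Real.exp_zero]; ring
  have h1 : 0 ≤ |b| + b := by linarith [neg_abs_le b]
  rw [h]
  have := mul_nonneg (abs_nonneg b) h1
  exact mul_pos (Real.exp_pos _) (by nlinarith)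

/-- **Maximum principle** for the Robin problem. At a positive maximum `ε` of `v / φ`, with `φ` the
barrier, `v - ε φ` attains its maximum `0`, which neither the heat equation nor the Robin condition
allows. Comparing through the quotient makes the sign of `b` irrelevant. -/
theorem IsRobinHeat.nonpos {b : ℝ} {v : ℝ → ℝ → ℝ} (hv : IsRobinHeat b v)
    (hc : ContinuousOn (fun p : ℝ × ℝ => v p.1 p.2) (Iic 0 ×ˢ Ici 0))
    (hgrowth : ∀ T > 0, ∃ C : ℝ, ∀ x < 0, ∀ t ∈ Ioc 0 T, v x t ≤ C * Real.exp (-|b| * x))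
    (hinit : ∀ x ≤ 0, v x 0 ≤ 0) : ∀ x ≤ 0, ∀ t ≥ 0, v x t ≤ 0 := by
  intro x₀ hx₀ t₀ ht₀
  by_contra! hpos
  have ht₀' : 0 < t₀ := by
    rcases ht₀.lt_or_eq with h | h
    · exact h
    · subst h; exact absurd (hinit x₀ hx₀) (not_le.2 hpos)
  set q : ℝ × ℝ → ℝ := fun p => v p.1 p.2 / robinBarrier b p.1 p.2 with hq
  have hq0 : 0 < q (x₀, t₀) := div_pos hpos (robinBarrier_pos _ _ _)
  obtain ⟨C, hC⟩ := hgrowth t₀ ht₀'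
  -- choose `R` with `q (-R, t) < q (x₀, t₀)`
  obtain ⟨R, hR0, hRx, hR⟩ : ∃ R : ℝ, 0 < R ∧ -x₀ < R ∧ |C| * Real.exp (-R) < q (x₀, t₀) := by
    have h1 : Tendsto (fun R : ℝ => |C| * Real.exp (-R)) atTop (𝓝 0) := by
      simpa using (Real.tendsto_exp_neg_atTop_nhds_zero.const_mul |C|)
    exact ((eventually_gt_atTop 0).and ((eventually_gt_atTop (-x₀)).and
      (h1.eventually_lt_const hq0))).exists
  have hside : ∀ t ∈ Ioc 0 t₀, q (-R, t) < q (x₀, t₀) := by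
    intro t ht
    refine lt_of_le_of_lt ?_ hR
    have h1 := hC (-R) (by linarith) t ht
    rw [hq]
    refine (div_le_iff₀ (robinBarrier_pos _ _ _)).2 (h1.trans ?_)
    have h2 : Real.exp ((|b| + 1) * R) ≤ robinBarrier b (-R) t := by
      have h3 : 1 ≤ Real.exp (((|b| + 1) ^ 2 + 1) * t) :=
        Real.one_le_exp (mul_nonneg (by positivity) ht.1.le)
      unfold robinBarrier
      have h4 : 0 ≤ 2 * (|b| + 1) * Real.exp ((|b| + 1) * -R) := by positivity
      have h5 : Real.exp (-(|b| + 1) * -R) = Real.exp ((|b| + 1) * R) := by congr 1; ring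
      rw [h5]
      nlinarith [Real.exp_pos ((|b| + 1) * R)]
    calc C * Real.exp (-|b| * -R) ≤ |C| * Real.exp (|b| * R) := by
          rw [neg_mul_neg]; gcongr; exact le_abs_self C
      _ = |C| * Real.exp (-R) * Real.exp ((|b| + 1) * R) := by
          rw [mul_assoc, ← Real.exp_add]; ring_nf
      _ ≤ _ := by gcongr
  have hqc : ContinuousOn q (Icc (-R) 0 ×ˢ Icc 0 t₀) :=
    (hc.mono (prod_mono Icc_subset_Iic_self Icc_subset_Ici_self)).div
      (continuous_robinBarrier b).continuousOn fun p _ => (robinBarrier_pos _ _ _).ne'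
  have hmem : (x₀, t₀) ∈ Icc (-R) 0 ×ˢ Icc 0 t₀ := ⟨⟨by linarith, hx₀⟩, ht₀, le_rfl⟩
  obtain ⟨⟨x, t⟩, ⟨hx, ht⟩, hmax⟩ :=
    (isCompact_Icc.prod isCompact_Icc).exists_isMaxOn ⟨_, hmem⟩ hqc
  simp only at hx ht
  set ε := q (x, t) with hε
  have hε0 : q (x₀, t₀) ≤ ε := hmax hmem
  have hεpos : 0 < ε := hq0.trans_le hε0
  have hle : ∀ y ∈ Icc (-R) 0, ∀ s ∈ Icc 0 t₀, v y s - ε * robinBarrier b y s ≤ 0 := by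
    intro y hy s hs
    have h1 : q (y, s) ≤ ε := hmax (show (y, s) ∈ _ from ⟨hy, hs⟩)
    have h2 := (div_le_iff₀ (robinBarrier_pos _ _ _)).1 h1
    simpa using h2
  have heq : v x t - ε * robinBarrier b x t = 0 := by
    rw [hε, hq]
    simp only
    rw [div_mul_cancel₀ _ (robinBarrier_pos _ _ _).ne', sub_self]
  have htpos : 0 < t := by
    rcases ht.1.lt_or_eq with h | h
    · exact h
    · have h1 := hinit x hx.2
      have h2 := mul_pos hεpos (robinBarrier_pos b x t)
      rw [← h] at heq h2
      linarith
  have hxR : -R < x := by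
    rcases hx.1.lt_or_eq with h | h
    · exact h
    · have h1 := hside t ⟨htpos, ht.2⟩
      rw [h] at h1
      exact absurd hε0 (not_le.2 h1)
  rcases hx.2.lt_or_eq with hx0 | hx0
  · obtain ⟨f, p, h1, h2, h3⟩ := hv.heat x hx0 t htpos
    have ht' := (h3.sub ((hasDerivAt_robinBarrier_time b x t).const_mul ε)).hasDerivWithinAt
      (s := Iic t) |>.nonneg_of_eventually_le_left <| by
        filter_upwards [Ioo_mem_nhdsLT htpos] with s hs
        simp only [Pi.sub_apply]
        rw [heq]
        exact hle x hx s ⟨hs.1.le, hs.2.le.trans ht.2⟩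
    have hloc : IsLocalMax (fun y => v y t - ε * robinBarrier b y t) x := by
      filter_upwards [Ioo_mem_nhds hxR hx0] with y hy
      rw [heq]
      exact hle y ⟨hy.1.le, hy.2.le⟩ t ht
    have hx' := hloc.second_deriv_nonpos
      (f' := fun y => f y - ε * robinBarrierDeriv b y t)
      (by
        filter_upwards [Iio_mem_nhds hx0] with y hy
        exact (h1 y hy).sub ((hasDerivAt_robinBarrier b y t).const_mul ε))
      (h2.sub ((hasDerivAt_robinBarrierDeriv b x t).const_mul ε))
    have := mul_pos hεpos (robinBarrier_pos b x t)
    nlinarith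
  · subst hx0
    have h1 := ((hv.robin t htpos).sub
      ((hasDerivAt_robinBarrier b 0 t).hasDerivWithinAt.const_mul ε)).nonneg_of_eventually_le_left
      <| by
        filter_upwards [Ioo_mem_nhdsLT hxR] with y hy
        simp only [Pi.sub_apply]
        rw [heq]
        exact hle y ⟨hy.1.le, hy.2.le⟩ t ht
    have h2 := mul_pos hεpos (robinBarrier_boundary b t)
    have h3 : v 0 t = ε * robinBarrier b 0 t := by linarith
    rw [h3] at h1
    nlinarith

/-- Solutions of the Robin problem on the half-line with at most exponential growth `e^{|b| |x|}`
are determined by their initial values. -/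
theorem IsRobinHeat.eq_of_initial {b : ℝ} {u v : ℝ → ℝ → ℝ}
    (hu : IsRobinHeat b u) (hv : IsRobinHeat b v)
    (huc : ContinuousOn (fun p : ℝ × ℝ => u p.1 p.2) (Iic 0 ×ˢ Ici 0))
    (hvc : ContinuousOn (fun p : ℝ × ℝ => v p.1 p.2) (Iic 0 ×ˢ Ici 0))
    (hug : ∀ T > 0, ∃ C : ℝ, ∀ x < 0, ∀ t ∈ Ioc 0 T, |u x t| ≤ C * Real.exp (-|b| * x))
    (hvg : ∀ T > 0, ∃ C : ℝ, ∀ x < 0, ∀ t ∈ Ioc 0 T, |v x t| ≤ C * Real.exp (-|b| * x))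
    (hinit : ∀ x ≤ 0, u x 0 = v x 0) {x t : ℝ} (hx : x ≤ 0) (ht : 0 ≤ t) : u x t = v x t := by
  have hg : ∀ T > 0, ∃ C : ℝ, ∀ x < 0, ∀ t ∈ Ioc 0 T,
      |u x t - v x t| ≤ C * Real.exp (-|b| * x) := by
    intro T hT
    obtain ⟨C, hC⟩ := hug T hT
    obtain ⟨D, hD⟩ := hvg T hT
    refine ⟨C + D, fun x hx t ht => (abs_sub _ _).trans ?_⟩
    rw [add_mul]
    exact add_le_add (hC x hx t ht) (hD x hx t ht)
  have h1 := (hu.sub hv).nonpos (huc.sub hvc)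
    (fun T hT => (hg T hT).imp fun C hC x hx t ht => (le_abs_self _).trans (hC x hx t ht))
    (fun x hx => (sub_eq_zero.2 (hinit x hx)).le) x hx t ht
  have h2 := (hv.sub hu).nonpos (hvc.sub huc)
    (fun T hT => (hg T hT).imp fun C hC x hx t ht => (le_abs_self _).trans <| by
      rw [abs_sub_comm]; exact hC x hx t ht)
    (fun x hx => (sub_eq_zero.2 (hinit x hx).symm).le) x hx t ht
  linarith

/-! ### The explicit solution -/

/-- The solution of the Robin problem with initial value `1`, by its classical formula in terms of
the error function for `t > 0`; the value at `t ≤ 0` is set to `1`. -/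
noncomputable def robinSolution (b x t : ℝ) : ℝ :=
  if 0 < t then
    erf (-x / (2 * √t)) + Real.exp (-b * x + b ^ 2 * t) * (1 - erf (-x / (2 * √t) + b * √t))
  else 1

theorem robinSolution_of_pos (b x : ℝ) {t : ℝ} (ht : 0 < t) :
    robinSolution b x t =
      erf (-x / (2 * √t)) +
        Real.exp (-b * x + b ^ 2 * t) * (1 - erf (-x / (2 * √t) + b * √t)) :=
  if_pos ht

theorem robinSolution_zero_right (b x : ℝ) : robinSolution b x 0 = 1 := if_neg (lt_irrefl 0)

/-- Completing the square: `(z + b√t)² = z² - b x + b² t` for `z = -x / (2√t)`. -/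
theorem exp_mul_exp_neg_sq_robin (b x : ℝ) {t : ℝ} (ht : 0 < t) :
    Real.exp (-b * x + b ^ 2 * t) * Real.exp (-(-x / (2 * √t) + b * √t) ^ 2) =
      Real.exp (-(-x / (2 * √t)) ^ 2) := by
  have hs : √t ≠ 0 := (Real.sqrt_pos.2 ht).ne'
  have h2 : √t ^ 2 = t := Real.sq_sqrt ht.le
  rw [← Real.exp_add]
  congr 1
  have h3 : (-x / (2 * √t) + b * √t) ^ 2 = (-x / (2 * √t)) ^ 2 + -x * b + b ^ 2 * √t ^ 2 := by
    field_simp; ring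
  rw [h3, h2]; ring

/-- The second summand of `robinSolution`; the space derivative of `robinSolution` is `-b` times
it. -/
noncomputable def robinSolutionAux (b x t : ℝ) : ℝ :=
  Real.exp (-b * x + b ^ 2 * t) * (1 - erf (-x / (2 * √t) + b * √t))

theorem hasDerivAt_robinSolutionAux (b x : ℝ) {t : ℝ} (ht : 0 < t) :
    HasDerivAt (fun y => robinSolutionAux b y t)
      (-b * robinSolutionAux b x t +
        2 / √Real.pi * Real.exp (-(-x / (2 * √t)) ^ 2) / (2 * √t)) x := by
  have hz : HasDerivAt (fun y : ℝ => -y / (2 * √t)) (-1 / (2 * √t)) x :=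
    (hasDerivAt_id x).neg.div_const _
  have he : HasDerivAt (fun y => Real.exp (-b * y + b ^ 2 * t))
      (Real.exp (-b * x + b ^ 2 * t) * (-b)) x :=
    ((((hasDerivAt_id x).const_mul (-b)).add_const _).exp).congr_deriv (by simp)
  have h := he.mul (((hasDerivAt_erf _).comp x (hz.add_const (b * √t))).const_sub 1)
  refine h.congr_deriv ?_
  rw [← exp_mul_exp_neg_sq_robin b x ht, robinSolutionAux]
  simp only [Function.comp]
  ring

theorem hasDerivAt_robinSolution (b x : ℝ) {t : ℝ} (ht : 0 < t) :
    HasDerivAt (fun y => robinSolution b y t) (-b * robinSolutionAux b x t) x := by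
  have hz : HasDerivAt (fun y : ℝ => -y / (2 * √t)) (-1 / (2 * √t)) x :=
    (hasDerivAt_id x).neg.div_const _
  have h := ((hasDerivAt_erf _).comp x hz).add (hasDerivAt_robinSolutionAux b x ht)
  have hfun : (fun y => robinSolution b y t) =
      (erf ∘ fun y : ℝ => -y / (2 * √t)) + fun y => robinSolutionAux b y t := by
    ext y; exact robinSolution_of_pos b y ht
  rw [hfun]
  exact h.congr_deriv (by ring)

theorem hasDerivAt_robinSolution_time (b x : ℝ) {t : ℝ} (ht : 0 < t) :
    HasDerivAt (fun s => robinSolution b x s)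
      (-b * (-b * robinSolutionAux b x t +
        2 / √Real.pi * Real.exp (-(-x / (2 * √t)) ^ 2) / (2 * √t))) t := by
  have hs := Real.hasDerivAt_sqrt ht.ne'
  have hs0 : √t ≠ 0 := (Real.sqrt_pos.2 ht).ne'
  have hz := (hasDerivAt_const t (-x)).div (hs.const_mul 2) (by positivity)
  have he : HasDerivAt (fun s => Real.exp (-b * x + b ^ 2 * s))
      (Real.exp (-b * x + b ^ 2 * t) * b ^ 2) t :=
    ((((hasDerivAt_id t).const_mul (b ^ 2)).const_add _).exp).congr_deriv (by simp)
  have h := ((hasDerivAt_erf _).comp t hz).add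
    (he.mul (((hasDerivAt_erf _).comp t (hz.add (hs.const_mul b))).const_sub 1))
  have hfun : (fun s => robinSolution b x s) =ᶠ[𝓝 t] fun s =>
      erf (-x / (2 * √s)) + Real.exp (-b * x + b ^ 2 * s) * (1 - erf (-x / (2 * √s) + b * √s)) := by
    filter_upwards [Ioi_mem_nhds ht] with s hs using robinSolution_of_pos b x hs
  refine HasDerivAt.congr_of_eventuallyEq (h.congr_deriv ?_) hfun
  simp only [Function.comp, Pi.add_apply, Pi.div_apply]
  rw [← exp_mul_exp_neg_sq_robin b x ht, robinSolutionAux]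
  field_simp
  ring

theorem robinSolution_zero_left (b : ℝ) {t : ℝ} (ht : 0 ≤ t) :
    robinSolution b 0 t = Real.exp (b ^ 2 * t) * (1 - erf (b * √t)) := by
  rcases ht.eq_or_lt with rfl | ht
  · simp [robinSolution_zero_right, erf_zero]
  · simp [robinSolution_of_pos b 0 ht, erf_zero]

theorem isRobinHeat_robinSolution (b : ℝ) : IsRobinHeat b (robinSolution b) where
  heat x _ t ht := ⟨fun y => -b * robinSolutionAux b y t, _,
    fun y _ => hasDerivAt_robinSolution b y ht,
    (hasDerivAt_robinSolutionAux b x ht).const_mul (-b), hasDerivAt_robinSolution_time b x ht⟩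
  robin t ht := by
    refine (hasDerivAt_robinSolution b 0 ht).hasDerivWithinAt.congr_deriv ?_
    rw [robinSolution_zero_left b ht.le]
    simp [robinSolutionAux]

theorem abs_robinSolution_le (b : ℝ) {x t T : ℝ} (hx : x < 0) (ht : t ∈ Ioc 0 T) :
    |robinSolution b x t| ≤ (1 + Real.exp (b ^ 2 * T) * 2) * Real.exp (-|b| * x) := by
  rw [robinSolution_of_pos b x ht.1]
  have h1 : 1 ≤ Real.exp (-|b| * x) :=
    Real.one_le_exp (by nlinarith [abs_nonneg b])
  have h2 : Real.exp (-b * x + b ^ 2 * t) ≤ Real.exp (b ^ 2 * T) * Real.exp (-|b| * x) := by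
    rw [← Real.exp_add, Real.exp_le_exp]
    nlinarith [neg_abs_le b, le_abs_self b, mul_le_mul_of_nonneg_left ht.2 (sq_nonneg b)]
  refine (abs_add_le _ _).trans ?_
  rw [abs_mul, abs_of_pos (Real.exp_pos _), add_mul, one_mul]
  refine add_le_add ((abs_le.2 ⟨neg_one_le_erf _, erf_le_one _⟩).trans h1) ?_
  refine (mul_le_mul h2 (abs_one_sub_erf_le _) (abs_nonneg _) (by positivity)).trans_eq ?_
  ring

theorem continuousOn_robinSolution (b : ℝ) :
    ContinuousOn (fun p : ℝ × ℝ => robinSolution b p.1 p.2) (Iic 0 ×ˢ Ici 0) := by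
  rintro ⟨x, t⟩ ⟨hx, ht⟩
  simp only [mem_Iic, mem_Ici] at hx ht
  rcases ht.eq_or_lt with rfl | ht
  · rw [ContinuousWithinAt]
    simp only [robinSolution_zero_right]
    unfold robinSolution
    refine Tendsto.if ?_ tendsto_const_nhds
    set l : Filter (ℝ × ℝ) := 𝓝[Iic 0 ×ˢ Ici 0] (x, 0) ⊓ 𝓟 {p | 0 < p.2} with hl
    have hl1 : l ≤ 𝓝 (x, 0) := inf_le_left.trans nhdsWithin_le_nhds
    have hpos : ∀ᶠ p in l, 0 < p.2 := mem_inf_of_right (mem_principal_self _)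
    have hsqrt : Tendsto (fun p : ℝ × ℝ => √p.2) l (𝓝 0) := by
      have : Continuous fun p : ℝ × ℝ => √p.2 := by fun_prop
      simpa using (this.tendsto (x, 0)).mono_left hl1
    have hexp : Tendsto (fun p : ℝ × ℝ => Real.exp (-b * p.1 + b ^ 2 * p.2)) l
        (𝓝 (Real.exp (-b * x))) := by
      have : Continuous fun p : ℝ × ℝ => Real.exp (-b * p.1 + b ^ 2 * p.2) := by fun_prop
      simpa using (this.tendsto (x, 0)).mono_left hl1
    -- split `erf z + e (1 - erf ζ) - 1 = (e - 1) (1 - erf ζ) + (erf z - erf ζ)`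
    have hA : Tendsto (fun p : ℝ × ℝ => (Real.exp (-b * p.1 + b ^ 2 * p.2) - 1) *
        (1 - erf (-p.1 / (2 * √p.2) + b * √p.2))) l (𝓝 0) := by
      rcases hx.eq_or_lt with rfl | hx
      · have h1 : Tendsto (fun p : ℝ × ℝ => Real.exp (-b * p.1 + b ^ 2 * p.2) - 1) l (𝓝 0) := by
          simpa using hexp.sub_const 1
        refine h1.zero_mul_isBoundedUnder_le ⟨2, ?_⟩
        rw [eventually_map]
        exact Eventually.of_forall fun p => abs_one_sub_erf_le _
      · have h1 : Tendsto (fun p : ℝ × ℝ => √p.2⁻¹) l atTop := by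
          have : Tendsto (fun p : ℝ × ℝ => (√p.2)⁻¹) l atTop :=
            tendsto_inv_nhdsGT_zero.comp (tendsto_nhdsWithin_iff.2
              ⟨hsqrt, hpos.mono fun p hp => Real.sqrt_pos.2 hp⟩)
          simpa only [Real.sqrt_inv] using this
        have h2 : Tendsto (fun p : ℝ × ℝ => -p.1 / 2) l (𝓝 (-x / 2)) := by
          have : Continuous fun p : ℝ × ℝ => -p.1 / 2 := by fun_prop
          exact (this.tendsto (x, 0)).mono_left hl1
        have h3 : Tendsto (fun p : ℝ × ℝ => -p.1 / (2 * √p.2) + b * √p.2) l atTop := by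
          refine (h2.pos_mul_atTop (by linarith) h1).atTop_add (hsqrt.const_mul b) |>.congr ?_
          intro p
          rw [Real.sqrt_inv]; ring
        have h4 := (hexp.sub_const 1).mul ((tendsto_erf_atTop.comp h3).const_sub 1)
        simpa using h4
    have hB : Tendsto (fun p : ℝ × ℝ => erf (-p.1 / (2 * √p.2)) -
        erf (-p.1 / (2 * √p.2) + b * √p.2)) l (𝓝 0) := by
      refine squeeze_zero_norm (fun p => (abs_erf_sub_erf_le _ _).trans_eq ?_)
        (a := fun p => 2 / √Real.pi * |b * √p.2|) ?_
      · rw [sub_add_cancel_left, abs_neg]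
      · simpa using ((hsqrt.const_mul b).abs).const_mul (2 / √Real.pi)
    have h := (hA.add hB).add_const 1
    simp only [add_zero, zero_add] at h
    exact h.congr fun p => by ring
  · have h : (fun p : ℝ × ℝ => robinSolution b p.1 p.2) =ᶠ[𝓝 (x, t)] fun p =>
        erf (-p.1 / (2 * √p.2)) + Real.exp (-b * p.1 + b ^ 2 * p.2) *
          (1 - erf (-p.1 / (2 * √p.2) + b * √p.2)) := by
      filter_upwards [continuousAt_snd.eventually (Ioi_mem_nhds ht)] with p hp
        using robinSolution_of_pos b p.1 hp
    refine (ContinuousAt.congr ?_ h.symm).continuousWithinAt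
    have hne : 2 * √t ≠ 0 := by positivity
    have hz : ContinuousAt (fun p : ℝ × ℝ => -p.1 / (2 * √p.2)) (x, t) :=
      ContinuousAt.div (by fun_prop) (by fun_prop) hne
    exact (continuous_erf.continuousAt.comp hz).add (ContinuousAt.mul (by fun_prop)
      (continuousAt_const.sub (continuous_erf.continuousAt.comp (f := fun p : ℝ × ℝ =>
        -p.1 / (2 * √p.2) + b * √p.2) (hz.add (by fun_prop)))))

/-! ### A Gaussian integral over the quarter disc -/

theorem two_div_sqrt_pi_sq : (2 / √Real.pi) ^ 2 = 4 / Real.pi := by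
  rw [div_pow, Real.sq_sqrt Real.pi_pos.le]; norm_num

theorem exp_neg_mul_sin_sq_mul_exp_neg_mul_cos_sq (a θ : ℝ) :
    Real.exp (-(a * Real.sin θ) ^ 2) * Real.exp (-(a * Real.cos θ) ^ 2) = Real.exp (-a ^ 2) := by
  rw [← Real.exp_add]
  congr 1
  linear_combination -a ^ 2 * Real.sin_sq_add_cos_sq θ

/-- `∫_0^{π/2} ∂_r [erf(r sin θ) r sin θ e^{-r² cos² θ}] dθ` in closed form: up to a multiple of
`∂_θ [erf(r sin θ) cos θ e^{-r² cos² θ}]`, which integrates to `0`, the integrand is constant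
in `θ`. -/
theorem integral_deriv_erf_sin_mul (r : ℝ) :
    ∫ θ in (0 : ℝ)..(Real.pi / 2),
      (2 / √Real.pi * Real.exp (-(r * Real.sin θ) ^ 2) * Real.sin θ *
          (2 / √Real.pi * (r * Real.sin θ * Real.exp (-(r * Real.cos θ) ^ 2))) +
        erf (r * Real.sin θ) * (2 / √Real.pi * (Real.sin θ * (1 - 2 * r ^ 2 * Real.cos θ ^ 2) *
          Real.exp (-(r * Real.cos θ) ^ 2)))) =
      2 * r * Real.exp (-r ^ 2) := by
  have hd : ∀ θ ∈ uIcc 0 (Real.pi / 2), HasDerivAt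
      (fun θ => 4 / Real.pi * (r * Real.exp (-r ^ 2)) * θ -
        2 / √Real.pi * (erf (r * Real.sin θ) *
          (Real.cos θ * Real.exp (-(r * Real.cos θ) ^ 2))))
      (2 / √Real.pi * Real.exp (-(r * Real.sin θ) ^ 2) * Real.sin θ *
          (2 / √Real.pi * (r * Real.sin θ * Real.exp (-(r * Real.cos θ) ^ 2))) +
        erf (r * Real.sin θ) * (2 / √Real.pi * (Real.sin θ * (1 - 2 * r ^ 2 * Real.cos θ ^ 2) *
          Real.exp (-(r * Real.cos θ) ^ 2)))) θ := by
    intro θ _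
    have h1 := (hasDerivAt_erf _).comp θ ((Real.hasDerivAt_sin θ).const_mul r)
    have h2 := ((((Real.hasDerivAt_cos θ).const_mul r).pow 2).neg).exp
    have h := ((hasDerivAt_id θ).const_mul (4 / Real.pi * (r * Real.exp (-r ^ 2)))).sub
      ((h1.mul ((Real.hasDerivAt_cos θ).mul h2)).const_mul (2 / √Real.pi))
    refine h.congr_deriv ?_
    simp only [Function.comp, Pi.mul_apply, Pi.neg_apply, Pi.pow_apply]
    rw [← two_div_sqrt_pi_sq, ← exp_neg_mul_sin_sq_mul_exp_neg_mul_cos_sq r θ]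
    push_cast
    linear_combination (-(2 / √Real.pi) ^ 2 * r * Real.exp (-(r * Real.sin θ) ^ 2) *
      Real.exp (-(r * Real.cos θ) ^ 2)) * Real.sin_sq_add_cos_sq θ
  rw [intervalIntegral.integral_eq_sub_of_hasDerivAt hd
    (Continuous.intervalIntegrable (by have := continuous_erf; fun_prop) _ _)]
  have := Real.pi_ne_zero
  simp [erf_zero]
  field_simp
  norm_num
  ring

/-- The mass `1 - e^{-a²}` that the Gaussian density `(4/π) e^{-x²-y²}` gives to the quarter disc
of radius `a`, integrated along `x = a cos θ`. -/
theorem integral_erf_sin_mul (a : ℝ) :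
    ∫ θ in (0 : ℝ)..(Real.pi / 2), erf (a * Real.sin θ) *
      (2 / √Real.pi * (a * Real.sin θ * Real.exp (-(a * Real.cos θ) ^ 2))) =
      1 - Real.exp (-a ^ 2) := by
  set F : ℝ → ℝ → ℝ := fun θ r =>
    2 / √Real.pi * Real.exp (-(r * Real.sin θ) ^ 2) * Real.sin θ *
        (2 / √Real.pi * (r * Real.sin θ * Real.exp (-(r * Real.cos θ) ^ 2))) +
      erf (r * Real.sin θ) * (2 / √Real.pi * (Real.sin θ * (1 - 2 * r ^ 2 * Real.cos θ ^ 2) *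
        Real.exp (-(r * Real.cos θ) ^ 2))) with hF
  have hFc : Continuous (Function.uncurry F) := by
    have := continuous_erf
    simp only [hF, Function.uncurry_def]
    fun_prop
  have hinner : ∀ θ : ℝ, erf (a * Real.sin θ) *
      (2 / √Real.pi * (a * Real.sin θ * Real.exp (-(a * Real.cos θ) ^ 2))) =
      ∫ r in (0 : ℝ)..a, F θ r := by
    intro θ
    have hd : ∀ r ∈ uIcc 0 a, HasDerivAt (fun r => erf (r * Real.sin θ) *
        (2 / √Real.pi * (r * Real.sin θ * Real.exp (-(r * Real.cos θ) ^ 2)))) (F θ r) r := by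
      intro r _
      have h1 := (hasDerivAt_erf _).comp r ((hasDerivAt_id r).mul_const (Real.sin θ))
      have h2 := (((((hasDerivAt_id r).mul_const (Real.cos θ)).pow 2).neg).exp)
      have h := h1.mul ((((hasDerivAt_id r).mul_const (Real.sin θ)).mul h2).const_mul
        (2 / √Real.pi))
      refine h.congr_deriv ?_
      simp only [hF, Function.comp, Pi.mul_apply, Pi.neg_apply, Pi.pow_apply, id]
      push_cast
      ring
    rw [intervalIntegral.integral_eq_sub_of_hasDerivAt hd
      ((hFc.comp (by fun_prop : Continuous fun r : ℝ => (θ, r))).intervalIntegrable _ _)]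
    simp
  have hswap : ∫ θ in (0 : ℝ)..(Real.pi / 2), ∫ r in (0 : ℝ)..a, F θ r =
      ∫ r in (0 : ℝ)..a, ∫ θ in (0 : ℝ)..(Real.pi / 2), F θ r :=
    intervalIntegral_intervalIntegral_swap (hFc.continuousOn.integrableOn_compact
      (isCompact_uIcc.prod isCompact_uIcc) |>.mono_set
        (prod_mono uIoc_subset_uIcc uIoc_subset_uIcc))
  simp only [hinner]
  rw [hswap]
  simp only [hF, integral_deriv_erf_sin_mul]
  have hd : ∀ r ∈ uIcc 0 a, HasDerivAt (fun r => -Real.exp (-r ^ 2))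
      (2 * r * Real.exp (-r ^ 2)) r := by
    intro r _
    refine ((hasDerivAt_pow 2 r).neg.exp.neg).congr_deriv ?_
    simp; ring
  rw [intervalIntegral.integral_eq_sub_of_hasDerivAt hd
    (Continuous.intervalIntegrable (by fun_prop) _ _)]
  simp; ring

theorem integral_one_sub_erf_sin_mul (a : ℝ) :
    ∫ θ in (0 : ℝ)..(Real.pi / 2),
      2 / √Real.pi * (a * Real.sin θ * Real.exp (-(a * Real.cos θ) ^ 2)) *
        (1 - erf (a * Real.sin θ)) = erf a - 1 + Real.exp (-a ^ 2) := by
  have hce := continuous_erf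
  have hd : ∀ θ ∈ uIcc 0 (Real.pi / 2), HasDerivAt (fun θ => -erf (a * Real.cos θ))
      (2 / √Real.pi * (a * Real.sin θ * Real.exp (-(a * Real.cos θ) ^ 2))) θ := by
    intro θ _
    refine ((hasDerivAt_erf _).comp θ ((Real.hasDerivAt_cos θ).const_mul a)).neg.congr_deriv ?_
    ring
  have h1 := intervalIntegral.integral_eq_sub_of_hasDerivAt hd
    (Continuous.intervalIntegrable (by fun_prop) _ _)
  simp only [Real.cos_pi_div_two, mul_zero, erf_zero, Real.cos_zero, mul_one] at h1
  have h2 := integral_erf_sin_mul a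
  have h3 := intervalIntegral.integral_sub (μ := volume) (a := 0) (b := Real.pi / 2)
    (f := fun θ => 2 / √Real.pi * (a * Real.sin θ * Real.exp (-(a * Real.cos θ) ^ 2)))
    (g := fun θ => erf (a * Real.sin θ) *
      (2 / √Real.pi * (a * Real.sin θ * Real.exp (-(a * Real.cos θ) ^ 2))))
    (Continuous.intervalIntegrable (by fun_prop) _ _)
    (Continuous.intervalIntegrable (by fun_prop) _ _)
  rw [h1, h2] at h3
  rw [show erf a - 1 + Real.exp (-a ^ 2) = -0 - -erf a - (1 - Real.exp (-a ^ 2)) by ring, ← h3]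
  congr 1
  ext θ
  ring

/-! ### The fractional equation for the boundary value -/

theorem fracKernel_zero_half {r : ℝ} (hr : 0 < r) :
    fracKernel 0 (1 / 2) r = (√Real.pi)⁻¹ * (√r)⁻¹ := by
  rw [fracKernel, Real.Gamma_one_half_eq, Real.sqrt_eq_rpow r, ← Real.rpow_neg hr.le]
  norm_num
  ring

theorem fracKernel_zero_half_eq (r : ℝ) :
    fracKernel 0 (1 / 2) r = (Real.Gamma (1 - 1 / 2))⁻¹ * r ^ (-(1 / 2) : ℝ) := by
  rw [fracKernel]
  norm_num
  ring

/-- The boundary value `e^{b² t} (1 - erf (b √t))` of the Robin problem with initial value `1`. -/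
noncomputable def robinBoundary (b t : ℝ) : ℝ := Real.exp (b ^ 2 * t) * (1 - erf (b * √t))

theorem continuous_robinBoundary (b : ℝ) : Continuous (robinBoundary b) := by
  have := continuous_erf
  unfold robinBoundary
  fun_prop

theorem hasDerivAt_robinBoundary (b : ℝ) {t : ℝ} (ht : 0 < t) :
    HasDerivAt (robinBoundary b)
      (b ^ 2 * robinBoundary b t - b * (2 / √Real.pi) * (2 * √t)⁻¹) t := by
  have he : HasDerivAt (fun s => Real.exp (b ^ 2 * s)) (Real.exp (b ^ 2 * t) * b ^ 2) t :=
    (((hasDerivAt_id t).const_mul (b ^ 2)).exp).congr_deriv (by simp)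
  have h := he.mul (((hasDerivAt_erf _).comp t
    ((Real.hasDerivAt_sqrt ht.ne').const_mul b)).const_sub 1)
  refine h.congr_deriv ?_
  have h1 : Real.exp (b ^ 2 * t) * Real.exp (-(b * √t) ^ 2) = 1 := by
    rw [← Real.exp_add, mul_pow, Real.sq_sqrt ht.le]; simp
  simp only [Function.comp, robinBoundary]
  linear_combination (-(2 / √Real.pi) * b * (2 * √t)⁻¹) * h1

theorem intervalIntegrable_deriv_robinBoundary (b : ℝ) {t : ℝ} (ht : 0 < t) :
    IntervalIntegrable (fun s => b ^ 2 * robinBoundary b s - b * (2 / √Real.pi) * (2 * √s)⁻¹)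
      volume 0 t := by
  refine (((continuous_robinBoundary b).intervalIntegrable _ _).const_mul _).sub
    (IntervalIntegrable.const_mul ?_ _)
  have h := (intervalIntegral.intervalIntegrable_rpow' (a := 0) (b := t) (r := -(1 / 2))
    (by norm_num)).const_mul (2 : ℝ)⁻¹
  refine h.congr fun s hs => ?_
  rw [uIoc_of_le ht.le] at hs
  rw [Real.rpow_neg hs.1.le, ← Real.sqrt_eq_rpow, mul_inv]

theorem image_mul_sin_sq_Ioo {t : ℝ} (ht : 0 < t) :
    (fun θ => t * Real.sin θ ^ 2) '' Ioo 0 (Real.pi / 2) = Ioo 0 t := by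
  apply Subset.antisymm
  · rintro _ ⟨θ, hθ, rfl⟩
    have h0 : 0 < Real.sin θ :=
      Real.sin_pos_of_pos_of_lt_pi hθ.1 (by linarith [hθ.2, Real.pi_pos])
    have h1 : Real.sin θ < 1 := by
      rw [← Real.sin_pi_div_two]
      exact Real.sin_lt_sin_of_lt_of_le_pi_div_two (by linarith [hθ.1, Real.pi_pos]) le_rfl hθ.2
    exact ⟨by positivity, mul_lt_of_lt_one_right ht (by nlinarith)⟩
  · rintro s ⟨hs0, hst⟩
    have h0 : 0 < √(s / t) := Real.sqrt_pos.2 (by positivity)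
    have h1 : √(s / t) < 1 := by
      rw [Real.sqrt_lt' one_pos, one_pow, div_lt_one ht]
      exact hst
    refine ⟨Real.arcsin √(s / t), ⟨Real.arcsin_pos.2 h0, Real.arcsin_lt_pi_div_two.2 h1⟩, ?_⟩
    simp only
    rw [Real.sin_arcsin (by linarith) h1.le, Real.sq_sqrt (by positivity), mul_div_cancel₀ _ ht.ne']

theorem injOn_mul_sin_sq {t : ℝ} (ht : 0 < t) :
    InjOn (fun θ => t * Real.sin θ ^ 2) (Ioo 0 (Real.pi / 2)) := by
  intro x hx y hy h
  have h1 : Real.sin x ^ 2 = Real.sin y ^ 2 := mul_left_cancel₀ ht.ne' h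
  have hpos : ∀ z ∈ Ioo 0 (Real.pi / 2), 0 ≤ Real.sin z := fun z hz =>
    Real.sin_nonneg_of_nonneg_of_le_pi hz.1.le (by linarith [hz.2, Real.pi_pos])
  have h2 := (pow_left_inj₀ (hpos x hx) (hpos y hy) two_ne_zero).1 h1
  exact Real.injOn_sin ⟨by linarith [hx.1, Real.pi_pos], hx.2.le⟩
    ⟨by linarith [hy.1, Real.pi_pos], hy.2.le⟩ h2

/-- Substituting `s = t sin² θ` removes the singularities at both ends of the half-order
fractional integral of the derivative of `robinBoundary`. -/
theorem abs_deriv_smul_fracKernel_mul (b : ℝ) {t θ : ℝ} (ht : 0 < t)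
    (hθ : θ ∈ Ioo 0 (Real.pi / 2)) :
    |2 * t * Real.sin θ * Real.cos θ| • (fracKernel 0 (1 / 2) (t - t * Real.sin θ ^ 2) *
      (b ^ 2 * robinBoundary b (t * Real.sin θ ^ 2) -
        b * (2 / √Real.pi) * (2 * √(t * Real.sin θ ^ 2))⁻¹)) =
    b * Real.exp (b ^ 2 * t) *
      (2 / √Real.pi * (b * √t * Real.sin θ * Real.exp (-(b * √t * Real.cos θ) ^ 2)) *
        (1 - erf (b * √t * Real.sin θ))) - 2 * b / Real.pi := by
  have hs : 0 < Real.sin θ :=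
    Real.sin_pos_of_pos_of_lt_pi hθ.1 (by linarith [hθ.2, Real.pi_pos])
  have hc : 0 < Real.cos θ := Real.cos_pos_of_mem_Ioo ⟨by linarith [hθ.1, Real.pi_pos], hθ.2⟩
  have h1 : t - t * Real.sin θ ^ 2 = t * Real.cos θ ^ 2 := by
    linear_combination -t * Real.sin_sq_add_cos_sq θ
  have hr : 0 < √t := Real.sqrt_pos.2 ht
  have hrt : √t ^ 2 = t := Real.sq_sqrt ht.le
  have hπ : 0 < √Real.pi := Real.sqrt_pos.2 Real.pi_pos
  have hππ : √Real.pi ^ 2 = Real.pi := Real.sq_sqrt Real.pi_pos.le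
  have hsq1 : √(t * Real.sin θ ^ 2) = √t * Real.sin θ := by
    rw [Real.sqrt_mul ht.le, Real.sqrt_sq hs.le]
  have hsq2 : √(t * Real.cos θ ^ 2) = √t * Real.cos θ := by
    rw [Real.sqrt_mul ht.le, Real.sqrt_sq hc.le]
  have hexp : Real.exp (b ^ 2 * (t * Real.sin θ ^ 2)) =
      Real.exp (b ^ 2 * t) * Real.exp (-(b * √t * Real.cos θ) ^ 2) := by
    rw [← Real.exp_add]
    congr 1
    rw [mul_pow, mul_pow, hrt]
    linear_combination b ^ 2 * t * Real.sin_sq_add_cos_sq θ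
  rw [h1, fracKernel_zero_half (by positivity), robinBoundary, hsq1, hsq2, hexp, smul_eq_mul,
    abs_of_pos (by positivity), ← mul_assoc b]
  set A := Real.exp (b ^ 2 * t) * Real.exp (-(b * √t * Real.cos θ) ^ 2) with hA
  have hlhs : 2 * t * Real.sin θ * Real.cos θ * ((√Real.pi)⁻¹ * (√t * Real.cos θ)⁻¹ *
      (b ^ 2 * (A * (1 - erf (b * √t * Real.sin θ))) -
        b * (2 / √Real.pi) * (2 * (√t * Real.sin θ))⁻¹)) =
      2 / √Real.pi * (√t * Real.sin θ) * (b ^ 2 * (A * (1 - erf (b * √t * Real.sin θ)))) -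
        2 * b / Real.pi := by
    nth_rewrite 1 [← hrt]
    rw [← hππ]
    rw [Real.sqrt_sq hπ.le]
    field_simp
  rw [hlhs, hA]
  ring

/-- The boundary value of the Robin problem satisfies the fractional equation
`∂_t^{1/2} E = -b E`. -/
theorem integral_fracKernel_mul_deriv_robinBoundary (b : ℝ) {t : ℝ} (ht : 0 < t) :
    IntegrableOn (fun s => fracKernel 0 (1 / 2) (t - s) *
      (b ^ 2 * robinBoundary b s - b * (2 / √Real.pi) * (2 * √s)⁻¹)) (Ioo 0 t) ∧
    ∫ s in Ioo 0 t, fracKernel 0 (1 / 2) (t - s) *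
      (b ^ 2 * robinBoundary b s - b * (2 / √Real.pi) * (2 * √s)⁻¹) =
      -b * robinBoundary b t := by
  have hd : ∀ θ ∈ Ioo 0 (Real.pi / 2), HasDerivWithinAt (fun θ => t * Real.sin θ ^ 2)
      (2 * t * Real.sin θ * Real.cos θ) (Ioo 0 (Real.pi / 2)) θ := fun θ _ => by
    refine ((((Real.hasDerivAt_sin θ).pow 2).const_mul t).congr_deriv ?_).hasDerivWithinAt
    push_cast; ring
  have hπ : 0 ≤ Real.pi / 2 := by positivity
  have hcont : Continuous fun θ => 2 / √Real.pi *
      (b * √t * Real.sin θ * Real.exp (-(b * √t * Real.cos θ) ^ 2)) *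
        (1 - erf (b * √t * Real.sin θ)) := by
    have := continuous_erf
    fun_prop
  rw [← image_mul_sin_sq_Ioo ht, integrableOn_image_iff_integrableOn_abs_deriv_smul
      measurableSet_Ioo hd (injOn_mul_sin_sq ht),
    integral_image_eq_integral_abs_deriv_smul measurableSet_Ioo hd (injOn_mul_sin_sq ht),
    integrableOn_congr_fun (fun θ hθ => abs_deriv_smul_fracKernel_mul b ht hθ) measurableSet_Ioo,
    setIntegral_congr_fun measurableSet_Ioo
      (fun θ hθ => abs_deriv_smul_fracKernel_mul b ht hθ)]
  constructor
  · exact (((hcont.const_mul _).sub continuous_const).continuousOn.integrableOn_Icc).mono_set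
      Ioo_subset_Icc_self
  · rw [← integral_Ioc_eq_integral_Ioo, ← intervalIntegral.integral_of_le hπ,
      intervalIntegral.integral_sub ((hcont.const_mul _).intervalIntegrable _ _)
        (continuous_const.intervalIntegrable _ _),
      intervalIntegral.integral_const_mul, integral_one_sub_erf_sin_mul,
      intervalIntegral.integral_const, robinBoundary]
    have h1 : Real.exp (b ^ 2 * t) * Real.exp (-(b * √t) ^ 2) = 1 := by
      rw [← Real.exp_add, mul_pow, Real.sq_sqrt ht.le]; simp
    have h2 : (Real.pi / 2 - 0) • (2 * b / Real.pi) = b := by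
      have := Real.pi_ne_zero
      rw [smul_eq_mul, sub_zero]; field_simp
    rw [h2]
    linear_combination b * h1

/-! ### Identification of bounded solutions -/

namespace IsBoundedRobinHeatSolution

variable {b c : ℝ} {w : ℝ → ℝ → ℝ}

theorem isRobinHeat (hw : IsBoundedRobinHeatSolution b c w) : IsRobinHeat b w where
  heat x hx t ht := by
    refine ⟨deriv (fun y => w y t), _, fun y hy => (hw.differentiable_x y hy t ht).hasDerivAt,
      (hw.differentiable_xx x hx t ht).hasDerivAt, ?_⟩
    rw [← sub_eq_zero.1 (hw.heat x hx t ht)]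
    exact (hw.differentiable_t x hx t ht).hasDerivAt
  robin t ht := by
    obtain ⟨d, hd, h⟩ := hw.robin t ht
    exact hd.congr_deriv (by linarith)

theorem initial_le (hw : IsBoundedRobinHeatSolution b c w) {x : ℝ} (hx : x ≤ 0) :
    w x 0 = -c := by
  rcases hx.lt_or_eq with hx | rfl
  · exact hw.initial x hx
  · have h1 : ContinuousOn (fun y => w y 0) (Iic 0) :=
      hw.continuousOn.comp (f := fun y : ℝ => (y, (0 : ℝ))) (by fun_prop)
        fun y hy => ⟨hy, le_refl (0 : ℝ)⟩
    have h2 : Tendsto (fun y => w y 0) (𝓝[<] 0) (𝓝 (w 0 0)) :=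
      (h1 0 (mem_Iic.2 le_rfl)).mono Iio_subset_Iic_self
    refine tendsto_nhds_unique h2 (tendsto_const_nhds.congr' ?_)
    filter_upwards [self_mem_nhdsWithin] with y hy using (hw.initial y hy).symm

/-- By uniqueness, the solution is `-c` times the one with initial value `1`. -/
theorem eq_robinSolution (hw : IsBoundedRobinHeatSolution b c w) {x t : ℝ} (hx : x ≤ 0)
    (ht : 0 ≤ t) : w x t = -c * robinSolution b x t := by
  refine hw.isRobinHeat.eq_of_initial ((isRobinHeat_robinSolution b).const_mul (-c))
    hw.continuousOn (continuousOn_const.mul (continuousOn_robinSolution b)) (fun T _ => ?_)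
    (fun T _ => ⟨|-c| * (1 + Real.exp (b ^ 2 * T) * 2), fun x hx t ht => ?_⟩)
    (fun x hx => ?_) hx ht
  · obtain ⟨M, hM⟩ := hw.bounded
    refine ⟨|M|, fun x hx t ht => (hM x hx t ht.1).trans ((le_abs_self M).trans ?_)⟩
    exact le_mul_of_one_le_right (abs_nonneg M)
      (Real.one_le_exp (by nlinarith [abs_nonneg b]))
  · rw [abs_mul, mul_assoc]
    exact mul_le_mul_of_nonneg_left (abs_robinSolution_le b hx ht) (abs_nonneg _)
  · rw [hw.initial_le hx, robinSolution_zero_right, mul_one]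

end IsBoundedRobinHeatSolution

theorem corollary1p3 (b c : ℝ) (w : ℝ → ℝ → ℝ) (hw : IsBoundedRobinHeatSolution b c w)
    (ξ : ℝ → ℝ) (hξ : ∀ t, ξ t = w 0 t) :
    -- the boundary value starts from `-c`, is continuous on `[0,∞)`, differentiable on `(0,∞)`,
    -- and its derivative is integrable near `0`
    ξ 0 = -c ∧
    ContinuousOn ξ (Ici 0) ∧
    (∀ t > 0, DifferentiableAt ℝ ξ t) ∧
    (∀ t > 0, IntervalIntegrable (deriv ξ) volume 0 t) ∧
    -- the integral in the equation converges, and the equation holds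
    (∀ t > 0,
      IntervalIntegrable (fun s => fracKernel 0 (1 / 2) (t - s) * deriv ξ s) volume 0 t ∧
      ∫ s in (0 : ℝ)..t, fracKernel 0 (1 / 2) (t - s) * deriv ξ s = -b * ξ t) ∧
    -- the same equation in terms of the Caputo half derivative
    (∀ t > 0, caputoDeriv (1 / 2) ξ t = -b * ξ t) := by
  
  have hb : ∀ t ≥ 0, ξ t = -c * robinBoundary b t := fun t ht => by
    rw [hξ, hw.eq_robinSolution le_rfl ht, robinSolution_zero_left b ht, robinBoundary]
  have hd : ∀ t > 0, HasDerivAt ξ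
      (-c * (b ^ 2 * robinBoundary b t - b * (2 / √Real.pi) * (2 * √t)⁻¹)) t := fun t ht => by
    refine ((hasDerivAt_robinBoundary b ht).const_mul (-c)).congr_of_eventuallyEq ?_
    filter_upwards [Ioi_mem_nhds ht] with s hs using hb s (le_of_lt hs)
  have hfrac : ∀ t > 0,
      IntervalIntegrable (fun s => fracKernel 0 (1 / 2) (t - s) * deriv ξ s) volume 0 t ∧
      ∫ s in (0 : ℝ)..t, fracKernel 0 (1 / 2) (t - s) * deriv ξ s = -b * ξ t := by
    intro t ht
    have hcongr : EqOn (fun s => fracKernel 0 (1 / 2) (t - s) * deriv ξ s)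
        (fun s => -c * (fracKernel 0 (1 / 2) (t - s) *
          (b ^ 2 * robinBoundary b s - b * (2 / √Real.pi) * (2 * √s)⁻¹))) (Ioo 0 t) := by
      intro s hs
      simp only [(hd s hs.1).deriv]
      ring
    obtain ⟨h1, h2⟩ := integral_fracKernel_mul_deriv_robinBoundary b ht
    constructor
    · rw [intervalIntegrable_iff_integrableOn_Ioo_of_le ht.le,
        integrableOn_congr_fun hcongr measurableSet_Ioo]
      exact h1.const_mul _
    · rw [intervalIntegral.integral_of_le ht.le, integral_Ioc_eq_integral_Ioo,
        setIntegral_congr_fun measurableSet_Ioo hcongr, integral_const_mul, h2, hb t ht.le]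
      ring
  refine ⟨by rw [hξ, hw.initial_le le_rfl], ?_, fun t ht => (hd t ht).differentiableAt,
    fun t ht => ?_, hfrac, fun t ht => ?_⟩
  · exact (continuousOn_const.mul (continuous_robinBoundary b).continuousOn).congr
      fun t ht => hb t ht
  · refine ((intervalIntegrable_deriv_robinBoundary b ht).const_mul (-c)).congr fun s hs => ?_
    rw [uIoc_of_le ht.le] at hs
    exact (hd s hs.1).deriv.symm
  · rw [caputoDeriv, ← (hfrac t ht).2, ← intervalIntegral.integral_const_mul]
    simp only [fracKernel_zero_half_eq, mul_assoc]
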